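/- **Syntax.** Formulae are built from variables and the unit constant $\mathbf 1$ by the binary connectives $\backslash, /, \cdot, \vee, \wedge$ and the unary connectives $\langle\rangle$, $[]^{-1}$ and $!$. A *stoup* is a finite multiset of formulae; a *tree term* is either a formula or a bracketed expression $[\Xi]$, where $\Xi$ is a meta-formula; a *meta-formula* is an expression $\zeta;\Gamma$, where $\zeta$ is a stoup and $\Gamma$ is a finite sequence of tree terms. The empty stoup is $\varnothing$, the empty sequence is $\Lambda$; the comma denotes concatenation of sequences and multiset union of stoups; $\varnothing;\Gamma$ is abbreviated to $\Gamma$. $\Xi(\Phi)$ denotes a meta-formula with a designated occurrence of a sub-meta-formula $\Phi$ (either the whole meta-formula or the content of a bracket at any depth). A *sequent* is $\Xi\to A$, where $\Xi$ is a meta-formula and $A$ is a formula. **The system $!_{\mathbf b}^{2018}\mathbf{MALC}^{*}\mathbf b(\mathrm{st})'$** has the axioms $A\to A$ and $\Lambda\to\mathbf 1$ and the following rules (premises before $\Longrightarrow$); cut is not one of its rules. - $/L$: $\zeta_1;\Gamma\to B$ and $\Xi(\zeta_2;\Delta_1,C,\Delta_2)\to D$ $\Longrightarrow$ $\Xi(\zeta_1,\zeta_2;\Delta_1,C/B,\Gamma,\Delta_2)\to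 D$. - $/R$: $\zeta;\Gamma,B\to C$ $\Longrightarrow$ $\zeta;\Gamma\to C/B$. - $\backslash L$: $\zeta_1;\Gamma\to A$ and $\Xi(\zeta_2;\Delta_1,C,\Delta_2)\to D$ $\Longrightarrow$ $\Xi(\zeta_1,\zeta_2;\Delta_1,\Gamma,A\backslash C,\Delta_2)\to D$. - $\backslash R$: $\zeta;A,\Gamma\to C$ $\Longrightarrow$ $\zeta;\Gamma\to A\backslash C$. - $\cdot L$: $\Xi(\zeta;\Delta_1,A,B,\Delta_2)\to D$ $\Longrightarrow$ $\Xi(\zeta;\Delta_1,A\cdot B,\Delta_2)\to D$. - $\cdot R$: $\zeta_1;\Delta\to A$ and $\zeta_2;\Gamma\to B$ $\Longrightarrow$ $\zeta_1,\zeta_2;\Delta,\Gamma\to A\cdot B$. - $\mathbf 1L$: $\Xi(\zeta;\Delta_1,\Delta_2)\to A$ $\Longrightarrow$ $\Xi(\zeta;\Delta_1,\mathbf 1,\Delta_2)\to A$. - $\vee L$: $\Xi(\zeta;\Delta_1,A_1,\Delta_2)\to C$ and $\Xi(\zeta;\Delta_1,A_2,\Delta_2)\to C$ $\Longrightarrow$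 $\Xi(\zeta;\Delta_1,A_1\vee A_2,\Delta_2)\to C$. - $\vee R_i$ ($i=1,2$): $\Xi\to A_i$ $\Longrightarrow$ $\Xi\to A_1\vee A_2$. - $\wedge L_j$ ($j=1,2$): $\Xi(\zeta;\Delta_1,A_j,\Delta_2)\to C$ $\Longrightarrow$ $\Xi(\zeta;\Delta_1,A_1\wedge A_2,\Delta_2)\to C$. - $\wedge R$: $\Xi\to A_1$ and $\Xi\to A_2$ $\Longrightarrow$ $\Xi\to A_1\wedge A_2$. - $[]^{-1}L$: $\Xi(\zeta;\Delta_1,A,\Delta_2)\to B$ $\Longrightarrow$ $\Xi(\zeta;\Delta_1,[\,[]^{-1}A\,],\Delta_2)\to B$. - $[]^{-1}R$: $[\Xi]\to A$ $\Longrightarrow$ $\Xi\to[]^{-1}A$. - $\langle\rangle L$: $\Xi(\zeta;\Delta_1,[A],\Delta_2)\to B$ $\Longrightarrow$ $\Xi(\zeta;\Delta_1,\langle\rangle A,\Delta_2)\to B$. - $\langle\rangle R$: $\Xi\to A$ $\Longrightarrow$ $[\Xi]\to\langle\rangle A$. - $!L$: $\Xi(\zeta,A;\Gamma_1,\Gamma_2)\to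 B$ $\Longrightarrow$ $\Xi(\zeta;\Gamma_1,!A,\Gamma_2)\to B$. - $!P$: $\Xi(\zeta;\Gamma_1,A,\Gamma_2)\to B$ $\Longrightarrow$ $\Xi(\zeta,A;\Gamma_1,\Gamma_2)\to B$. - $!R'$: $A;\Lambda\to B$ $\Longrightarrow$ $A;\Lambda\to{!}B$. - $!C'$: $\Xi(\zeta,A;\Gamma_1,[\zeta',A;\Gamma_2],\Gamma_3)\to B$ $\Longrightarrow$ $\Xi(\zeta,A;\Gamma_1,[[\zeta';\Gamma_2]],\Gamma_3)\to B$. **Its version with Lambek's non-emptiness restriction** is obtained by removing $\mathbf 1$ from the language together with its axiom and rule, by requiring in $/R$ and $\backslash R$ that $\Gamma\ne\Lambda$ or $\zeta\neq\varnothing$, and by requiring in $!C'$ that $\Gamma_2\ne\Lambda$ or $\zeta'\ne\varnothing$. **Theorem (admissibility of cut).** In each of these two systems the following holds: if the sequents $\xi;\Pi\to A$ and $\Xi(\zeta;\Gamma_1,A,\Gamma_2)\to C$ are derivable, then the sequent $\Xi(\xi,\zeta;\Gamma_1,\Pi,\Gamma_2)\to C$ is derivable in the same system. -/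

import Mathlib

/-!
Bracketed multiplicative-additive Lambek calculus with a subexponential and stoups: the system with
the modified rules for `!`, and its version with Lambek's non-emptiness restriction.
-/

namespace BracketLambek

universe u

/-- The two versions of the calculus: `star` allows empty antecedents and bracketed domains and has
the unit constant, `restricted` obeys Lambek's non-emptiness restriction and has no unit constant. -/
inductive Version : Type
  | star
  | restricted

/-- Formulae over a type `Var` of variables. The unit constant `𝟏` belongs to the language of the
`star` version only. -/
inductive Formula (v : Version) (Var : Type u) : Type u
  /-- a variable (primitive type) -/
  | var (p : Var) : Formula v Var
  /-- the unit `𝟏` -/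
  | one (h : v = Version.star) : Formula v Var
  /-- left division: `ldiv A C` is `A \ C` -/
  | ldiv (A C : Formula v Var) : Formula v Var
  /-- right division: `rdiv C B` is `C / B` -/
  | rdiv (C B : Formula v Var) : Formula v Var
  /-- product `A · B` -/
  | prod (A B : Formula v Var) : Formula v Var
  /-- additive disjunction `A₁ ∨ A₂` -/
  | disj (A₁ A₂ : Formula v Var) : Formula v Var
  /-- additive conjunction `A₁ ∧ A₂` -/
  | conj (A₁ A₂ : Formula v Var) : Formula v Var
  /-- bracket modality `⟨⟩ A` -/
  | dia (A : Formula v Var) : Formula v Var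
  /-- bracket modality `[]⁻¹ A` -/
  | boxInv (A : Formula v Var) : Formula v Var
  /-- subexponential `! A` -/
  | bang (A : Formula v Var) : Formula v Var

/-- A stoup is a finite multiset of formulae. -/
abbrev Stoup (v : Version) (Var : Type u) := Multiset (Formula v Var)

mutual

/-- A tree term is a formula or a bracketed meta-formula `[Ξ]`. -/
inductive TreeTerm (v : Version) (Var : Type u) : Type u
  | fm (A : Formula v Var) : TreeTerm v Var
  | br (Ξ : MetaFormula v Var) : TreeTerm v Var

/-- A meta-formula `ζ; Γ`, written `⟨ζ, Γ⟩`, is a stoup `ζ` with a finite (possibly empty) sequence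
`Γ` of tree terms. -/
inductive MetaFormula (v : Version) (Var : Type u) : Type u
  | mk (ζ : Multiset (Formula v Var)) (Γ : List (TreeTerm v Var)) : MetaFormula v Var

end

/-- Meta-formulae `Ξ( )` with one designated sub-meta-formula left open: either the whole
meta-formula (`hole`), or one inside a bracketed domain: `ζ; Δ₁, [Ξ( )], Δ₂`. -/
inductive Context (v : Version) (Var : Type u) : Type u
  | hole : Context v Var
  | inside (ζ : Stoup v Var) (Δ₁ : List (TreeTerm v Var)) (Ξ : Context v Var)
      (Δ₂ : List (TreeTerm v Var)) : Context v Var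

/-- `Ξ.fill Φ` is the meta-formula `Ξ(Φ)`. -/
def Context.fill {v : Version} {Var : Type u} :
    Context v Var → MetaFormula v Var → MetaFormula v Var
  | .hole, Φ => Φ
  | .inside ζ Δ₁ Ξ Δ₂, Φ => ⟨ζ, Δ₁ ++ TreeTerm.br (Ξ.fill Φ) :: Δ₂⟩

open TreeTerm Formula

/-- `Derivable Ξ A` says that the sequent `Ξ → A` has a (cut-free) derivation in the version `v` of
the calculus. There is no cut rule. The three hypotheses that begin with
`v = Version.restricted →` are Lambek's restriction. -/
inductive Derivable {v : Version} {Var : Type u} : MetaFormula v Var → Formula v Var → Prop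
  | id (A : Formula v Var) :
      Derivable ⟨0, [fm A]⟩ A
  | rdivL (Ξ : Context v Var) (ζ₁ ζ₂ : Stoup v Var) (Δ₁ Γ Δ₂ : List (TreeTerm v Var))
      (B C D : Formula v Var) :
      Derivable ⟨ζ₁, Γ⟩ B →
      Derivable (Ξ.fill ⟨ζ₂, Δ₁ ++ [fm C] ++ Δ₂⟩) D →
      Derivable (Ξ.fill ⟨ζ₁ + ζ₂, Δ₁ ++ [fm (rdiv C B)] ++ Γ ++ Δ₂⟩) D
  | rdivR (ζ : Stoup v Var) (Γ : List (TreeTerm v Var)) (B C : Formula v Var) :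
      (v = Version.restricted → Γ ≠ [] ∨ ζ ≠ 0) →
      Derivable ⟨ζ, Γ ++ [fm B]⟩ C →
      Derivable ⟨ζ, Γ⟩ (rdiv C B)
  | ldivL (Ξ : Context v Var) (ζ₁ ζ₂ : Stoup v Var) (Δ₁ Γ Δ₂ : List (TreeTerm v Var))
      (A C D : Formula v Var) :
      Derivable ⟨ζ₁, Γ⟩ A →
      Derivable (Ξ.fill ⟨ζ₂, Δ₁ ++ [fm C] ++ Δ₂⟩) D →
      Derivable (Ξ.fill ⟨ζ₁ + ζ₂, Δ₁ ++ Γ ++ [fm (ldiv A C)] ++ Δ₂⟩) D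
  | ldivR (ζ : Stoup v Var) (Γ : List (TreeTerm v Var)) (A C : Formula v Var) :
      (v = Version.restricted → Γ ≠ [] ∨ ζ ≠ 0) →
      Derivable ⟨ζ, [fm A] ++ Γ⟩ C →
      Derivable ⟨ζ, Γ⟩ (ldiv A C)
  | prodL (Ξ : Context v Var) (ζ : Stoup v Var) (Δ₁ Δ₂ : List (TreeTerm v Var))
      (A B D : Formula v Var) :
      Derivable (Ξ.fill ⟨ζ, Δ₁ ++ [fm A, fm B] ++ Δ₂⟩) D →
      Derivable (Ξ.fill ⟨ζ, Δ₁ ++ [fm (prod A B)] ++ Δ₂⟩) D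
  | prodR (ζ₁ ζ₂ : Stoup v Var) (Δ Γ : List (TreeTerm v Var)) (A B : Formula v Var) :
      Derivable ⟨ζ₁, Δ⟩ A →
      Derivable ⟨ζ₂, Γ⟩ B →
      Derivable ⟨ζ₁ + ζ₂, Δ ++ Γ⟩ (prod A B)
  | oneL (h : v = Version.star) (Ξ : Context v Var) (ζ : Stoup v Var)
      (Δ₁ Δ₂ : List (TreeTerm v Var)) (A : Formula v Var) :
      Derivable (Ξ.fill ⟨ζ, Δ₁ ++ Δ₂⟩) A →
      Derivable (Ξ.fill ⟨ζ, Δ₁ ++ [fm (one h)] ++ Δ₂⟩) A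
  | oneR (h : v = Version.star) :
      Derivable ⟨0, []⟩ (one h)
  | disjL (Ξ : Context v Var) (ζ : Stoup v Var) (Δ₁ Δ₂ : List (TreeTerm v Var))
      (A₁ A₂ C : Formula v Var) :
      Derivable (Ξ.fill ⟨ζ, Δ₁ ++ [fm A₁] ++ Δ₂⟩) C →
      Derivable (Ξ.fill ⟨ζ, Δ₁ ++ [fm A₂] ++ Δ₂⟩) C →
      Derivable (Ξ.fill ⟨ζ, Δ₁ ++ [fm (disj A₁ A₂)] ++ Δ₂⟩) C
  | disjR₁ (Ξ : MetaFormula v Var) (A₁ A₂ : Formula v Var) :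
      Derivable Ξ A₁ →
      Derivable Ξ (disj A₁ A₂)
  | disjR₂ (Ξ : MetaFormula v Var) (A₁ A₂ : Formula v Var) :
      Derivable Ξ A₂ →
      Derivable Ξ (disj A₁ A₂)
  | conjL₁ (Ξ : Context v Var) (ζ : Stoup v Var) (Δ₁ Δ₂ : List (TreeTerm v Var))
      (A₁ A₂ C : Formula v Var) :
      Derivable (Ξ.fill ⟨ζ, Δ₁ ++ [fm A₁] ++ Δ₂⟩) C →
      Derivable (Ξ.fill ⟨ζ, Δ₁ ++ [fm (conj A₁ A₂)] ++ Δ₂⟩) C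
  | conjL₂ (Ξ : Context v Var) (ζ : Stoup v Var) (Δ₁ Δ₂ : List (TreeTerm v Var))
      (A₁ A₂ C : Formula v Var) :
      Derivable (Ξ.fill ⟨ζ, Δ₁ ++ [fm A₂] ++ Δ₂⟩) C →
      Derivable (Ξ.fill ⟨ζ, Δ₁ ++ [fm (conj A₁ A₂)] ++ Δ₂⟩) C
  | conjR (Ξ : MetaFormula v Var) (A₁ A₂ : Formula v Var) :
      Derivable Ξ A₁ →
      Derivable Ξ A₂ →
      Derivable Ξ (conj A₁ A₂)
  | boxInvL (Ξ : Context v Var) (ζ : Stoup v Var) (Δ₁ Δ₂ : List (TreeTerm v Var))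
      (A B : Formula v Var) :
      Derivable (Ξ.fill ⟨ζ, Δ₁ ++ [fm A] ++ Δ₂⟩) B →
      Derivable (Ξ.fill ⟨ζ, Δ₁ ++ [br ⟨0, [fm (boxInv A)]⟩] ++ Δ₂⟩) B
  | boxInvR (Ξ : MetaFormula v Var) (A : Formula v Var) :
      Derivable ⟨0, [br Ξ]⟩ A →
      Derivable Ξ (boxInv A)
  | diaL (Ξ : Context v Var) (ζ : Stoup v Var) (Δ₁ Δ₂ : List (TreeTerm v Var))
      (A B : Formula v Var) :
      Derivable (Ξ.fill ⟨ζ, Δ₁ ++ [br ⟨0, [fm A]⟩] ++ Δ₂⟩) B →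
      Derivable (Ξ.fill ⟨ζ, Δ₁ ++ [fm (dia A)] ++ Δ₂⟩) B
  | diaR (Ξ : MetaFormula v Var) (A : Formula v Var) :
      Derivable Ξ A →
      Derivable ⟨0, [br Ξ]⟩ (dia A)
  | bangL (Ξ : Context v Var) (ζ : Stoup v Var) (Γ₁ Γ₂ : List (TreeTerm v Var))
      (A B : Formula v Var) :
      Derivable (Ξ.fill ⟨ζ + {A}, Γ₁ ++ Γ₂⟩) B →
      Derivable (Ξ.fill ⟨ζ, Γ₁ ++ [fm (bang A)] ++ Γ₂⟩) B
  | bangP (Ξ : Context v Var) (ζ : Stoup v Var) (Γ₁ Γ₂ : List (TreeTerm v Var))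
      (A B : Formula v Var) :
      Derivable (Ξ.fill ⟨ζ, Γ₁ ++ [fm A] ++ Γ₂⟩) B →
      Derivable (Ξ.fill ⟨ζ + {A}, Γ₁ ++ Γ₂⟩) B
  | bangR (A B : Formula v Var) :
      Derivable ⟨{A}, []⟩ B →
      Derivable ⟨{A}, []⟩ (bang B)
  | bangC (Ξ : Context v Var) (ζ ζ' : Stoup v Var) (Γ₁ Γ₂ Γ₃ : List (TreeTerm v Var))
      (A B : Formula v Var) :
      (v = Version.restricted → Γ₂ ≠ [] ∨ ζ' ≠ 0) →
      Derivable (Ξ.fill ⟨ζ + {A}, Γ₁ ++ [br ⟨ζ' + {A}, Γ₂⟩] ++ Γ₃⟩) B →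
      Derivable (Ξ.fill ⟨ζ + {A}, Γ₁ ++ [br ⟨0, [br ⟨ζ', Γ₂⟩]⟩] ++ Γ₃⟩) B

end BracketLambek

/-!
Admissibility of cut, by a semantic argument: formulae are interpreted as closed sets of
meta-formulae, closedness being defined by cut-free derivability, such that
`A ∈ sem A ⊆ {Φ | Derivable Φ A}`. The interpretation validates all rules and cut.
-/

namespace BracketLambek

open TreeTerm Formula

universe u

variable {v : Version} {Var : Type u}

-- This is a phase-semantic proof of cut elimination in the manner of Okada. A frame together with a
-- succedent is a test, passed by a meta-formula if filling the frame with it gives a cut-free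
-- derivable sequent. `cl X` is the set of meta-formulae passing every test that all of `X` passes.
-- The left rules say exactly what a formula's tests accept; the right rules say that the generators
-- of its interpretation derive it. Together they give `sem_spec`: `sem A` is closed, contains `A`,
-- and has only elements deriving `A`.
--
-- The second pillar is `Derivable.sound`: if each formula in the antecedent of a derivable sequent
-- is replaced by an element of its interpretation, the result lies in the interpretation of the
-- succedent. Formulae in sequences may become whole meta-formulae, but a stoup formula may only
-- become a single stoup formula. This, with `sem (bang A)` generated by one-formula stoups, is what
-- the modified rules for `!` permit: promotion needs a one-formula stoup and contraction copies one
-- stoup formula.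
--
-- For cut, the antecedent of the left premise is an instance of itself, hence lies in the
-- interpretation of the cut formula. Putting it in place of the cut formula gives an instance of
-- the right antecedent, and soundness followed by `sem_spec` gives derivability.
--
-- In the restricted version the interpretations of the divisions exclude vacuous meta-formulae.
-- This condition is closed because derivable sequents have no vacuous parts (`Derivable.legal`).

/-- Composition of contexts. -/
def Context.comp : Context v Var → Context v Var → Context v Var
  | .hole, Θ => Θ
  | .inside ζ Δ₁ Ξ Δ₂, Θ => .inside ζ Δ₁ (Ξ.comp Θ) Δ₂

theorem Context.fill_comp (Ξ Θ : Context v Var) (Φ : MetaFormula v Var) :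
    (Ξ.comp Θ).fill Φ = Ξ.fill (Θ.fill Φ) := by
  induction Ξ with
  | hole => rfl
  | inside ζ Δ₁ Ξ Δ₂ ih => simp [Context.comp, Context.fill, ih]

-- Frames: contexts open at a segment

/-- A context whose designated place is a segment `ζ; Γ` of a meta-formula
`ζ, ζ₀; Δ₁, Γ, Δ₂`. -/
structure Frame (v : Version) (Var : Type u) : Type u where
  ctx : Context v Var
  stoup : Stoup v Var
  left : List (TreeTerm v Var)
  right : List (TreeTerm v Var)

namespace Frame

/-- Filling the designated place of a frame. -/
def app (K : Frame v Var) : MetaFormula v Var → MetaFormula v Var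
  | ⟨ζ, Γ⟩ => K.ctx.fill ⟨ζ + K.stoup, K.left ++ Γ ++ K.right⟩

/-- The frame that consists of the designated place alone. -/
def id : Frame v Var := ⟨.hole, 0, [], []⟩

theorem app_id (Φ : MetaFormula v Var) : id.app Φ = Φ := by
  cases Φ; simp [id, app, Context.fill]

/-- Composition of frames. -/
def comp (K : Frame v Var) : Frame v Var → Frame v Var
  | ⟨.hole, ζ, Γ₁, Γ₂⟩ => ⟨K.ctx, ζ + K.stoup, K.left ++ Γ₁, Γ₂ ++ K.right⟩
  | ⟨.inside η Δ₁ Ξ Δ₂, ζ, Γ₁, Γ₂⟩ =>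
      ⟨K.ctx.comp (.inside (η + K.stoup) (K.left ++ Δ₁) Ξ (Δ₂ ++ K.right)), ζ, Γ₁, Γ₂⟩

theorem app_comp (K L : Frame v Var) (Φ : MetaFormula v Var) :
    (K.comp L).app Φ = K.app (L.app Φ) := by
  obtain ⟨Ξ, ζ, Γ₁, Γ₂⟩ := L
  cases Φ
  cases Ξ <;> simp [comp, app, Context.fill, Context.fill_comp, add_assoc]

end Frame

-- Non-emptiness under Lambek's restriction

/-- A meta-formula is vacuous if its stoup and its sequence are empty. -/
def MetaFormula.NonVacuous : MetaFormula v Var → Prop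
  | ⟨ζ, Γ⟩ => Γ ≠ [] ∨ ζ ≠ 0

/-- No bracketed domain at any depth in the sequence is vacuous. -/
inductive LegalSeq : List (TreeTerm v Var) → Prop
  | nil : LegalSeq []
  | fm (A : Formula v Var) {Γ : List (TreeTerm v Var)} : LegalSeq Γ → LegalSeq (fm A :: Γ)
  | br {η : Stoup v Var} {Δ Γ : List (TreeTerm v Var)} :
      (Δ ≠ [] ∨ η ≠ 0) → LegalSeq Δ → LegalSeq Γ → LegalSeq (br ⟨η, Δ⟩ :: Γ)

/-- Neither the meta-formula nor any bracketed domain in it is vacuous. -/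
def MetaFormula.Legal : MetaFormula v Var → Prop
  | ⟨ζ, Γ⟩ => (Γ ≠ [] ∨ ζ ≠ 0) ∧ LegalSeq Γ

@[simp] theorem legalSeq_nil : LegalSeq ([] : List (TreeTerm v Var)) := .nil

@[simp] theorem legalSeq_fm {A : Formula v Var} {Γ : List (TreeTerm v Var)} :
    LegalSeq (fm A :: Γ) ↔ LegalSeq Γ :=
  ⟨fun h => by cases h; assumption, .fm A⟩

@[simp] theorem legalSeq_br {Φ : MetaFormula v Var} {Γ : List (TreeTerm v Var)} :
    LegalSeq (br Φ :: Γ) ↔ Φ.Legal ∧ LegalSeq Γ := by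
  obtain ⟨η, Δ⟩ := Φ
  refine ⟨fun h => ?_, fun h => .br h.1.1 h.1.2 h.2⟩
  cases h with
  | br h₁ h₂ h₃ => exact ⟨⟨h₁, h₂⟩, h₃⟩

@[simp] theorem legalSeq_append {Γ Δ : List (TreeTerm v Var)} :
    LegalSeq (Γ ++ Δ) ↔ LegalSeq Γ ∧ LegalSeq Δ := by
  induction Γ with
  | nil => simp
  | cons T Γ ih => cases T <;> simp [ih, and_assoc]

/-- Reduces a left rule to its active part: every level enclosing the hole contains a bracket, so it
cannot be vacuous. -/
theorem MetaFormula.Legal.fill_mono {Φ Ψ : MetaFormula v Var} (h : Φ.Legal → Ψ.Legal)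
    (Ξ : Context v Var) : (Ξ.fill Φ).Legal → (Ξ.fill Ψ).Legal := by
  induction Ξ with
  | hole => exact h
  | inside ζ Δ₁ Ξ Δ₂ ih =>
    simp only [Context.fill, MetaFormula.Legal, legalSeq_append, legalSeq_br]
    rintro ⟨-, h₁, h₂, h₃⟩
    exact ⟨by simp, h₁, ih h₂, h₃⟩

/-- Under Lambek's restriction, derivable sequents have no vacuous parts. -/
theorem Derivable.legal (hv : v = Version.restricted) {Φ : MetaFormula v Var}
    {A : Formula v Var} (h : Derivable Φ A) : Φ.Legal := by
  induction h with
  | id A => simp [MetaFormula.Legal]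
  | rdivL Ξ ζ₁ ζ₂ Δ₁ Γ Δ₂ B C D _ _ ih₁ ih₂ =>
    refine MetaFormula.Legal.fill_mono (fun h => ?_) Ξ ih₂
    simp_all [MetaFormula.Legal]
  | ldivL Ξ ζ₁ ζ₂ Δ₁ Γ Δ₂ B C D _ _ ih₁ ih₂ =>
    refine MetaFormula.Legal.fill_mono (fun h => ?_) Ξ ih₂
    simp_all [MetaFormula.Legal]
  | rdivR ζ Γ B C h _ ih =>
    have := h hv
    simp_all [MetaFormula.Legal]
  | ldivR ζ Γ B C h _ ih =>
    have := h hv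
    simp_all [MetaFormula.Legal]
  | prodR ζ₁ ζ₂ Δ Γ A B _ _ ih₁ ih₂ =>
    simp only [MetaFormula.Legal, legalSeq_append] at *
    refine ⟨?_, ih₁.2, ih₂.2⟩
    rcases ih₁.1 with h | h
    · exact .inl (by simp [h])
    · exact .inr (by simp [h])
  | oneL h => simp [hv] at h
  | oneR h => simp [hv] at h
  | disjL Ξ ζ Δ₁ Δ₂ A₁ A₂ C _ _ ih₁ ih₂ =>
    refine MetaFormula.Legal.fill_mono (fun h => ?_) Ξ ih₁
    simp_all [MetaFormula.Legal]
  | disjR₁ _ _ _ _ ih => exact ih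
  | disjR₂ _ _ _ _ ih => exact ih
  | conjR _ _ _ _ _ ih => exact ih
  | boxInvR Ξ A _ ih => simpa [MetaFormula.Legal] using ih
  | diaR Ξ A _ ih => simpa [MetaFormula.Legal] using ih
  | bangR _ _ _ ih => exact ih
  | prodL Ξ _ _ _ _ _ _ _ ih =>
    refine MetaFormula.Legal.fill_mono (fun h => ?_) Ξ ih
    simp_all [MetaFormula.Legal]
  | conjL₁ Ξ _ _ _ _ _ _ _ ih =>
    refine MetaFormula.Legal.fill_mono (fun h => ?_) Ξ ih
    simp_all [MetaFormula.Legal]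
  | conjL₂ Ξ _ _ _ _ _ _ _ ih =>
    refine MetaFormula.Legal.fill_mono (fun h => ?_) Ξ ih
    simp_all [MetaFormula.Legal]
  | boxInvL Ξ _ _ _ _ _ _ ih =>
    refine MetaFormula.Legal.fill_mono (fun h => ?_) Ξ ih
    simp_all [MetaFormula.Legal]
  | diaL Ξ _ _ _ _ _ _ ih =>
    refine MetaFormula.Legal.fill_mono (fun h => ?_) Ξ ih
    simp_all [MetaFormula.Legal]
  | bangL Ξ _ _ _ _ _ _ ih =>
    refine MetaFormula.Legal.fill_mono (fun h => ?_) Ξ ih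
    simp_all [MetaFormula.Legal]
  | bangP Ξ _ _ _ _ _ _ ih =>
    refine MetaFormula.Legal.fill_mono (fun h => ?_) Ξ ih
    simp_all [MetaFormula.Legal]
  | bangC Ξ _ _ _ _ _ _ _ hr _ ih =>
    have := hr hv
    refine MetaFormula.Legal.fill_mono (fun h => ?_) Ξ ih
    simp_all [MetaFormula.Legal]

theorem MetaFormula.Legal.nonVacuous {Φ : MetaFormula v Var} (h : Φ.Legal) : Φ.NonVacuous := by
  cases Φ
  exact h.1

-- The closure operator

/-- Concatenation of meta-formulae. -/
def MetaFormula.mul : MetaFormula v Var → MetaFormula v Var → MetaFormula v Var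
  | ⟨ζ, Γ⟩, ⟨η, Δ⟩ => ⟨ζ + η, Γ ++ Δ⟩

/-- The closure of a set of meta-formulae: the intersection of all the sets
`{Φ | Derivable (K.app Φ) D}` that include it. -/
def cl (X : Set (MetaFormula v Var)) : Set (MetaFormula v Var) :=
  {Φ | ∀ (K : Frame v Var) (D : Formula v Var),
    (∀ Ψ ∈ X, Derivable (K.app Ψ) D) → Derivable (K.app Φ) D}

theorem subset_cl (X : Set (MetaFormula v Var)) : X ⊆ cl X :=
  fun Φ hΦ _ _ h => h Φ hΦ

theorem cl_mono {X Y : Set (MetaFormula v Var)} (h : X ⊆ Y) : cl X ⊆ cl Y :=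
  fun _ hΦ K D hY => hΦ K D fun Ψ hΨ => hY Ψ (h hΨ)

theorem cl_cl (X : Set (MetaFormula v Var)) : cl (cl X) ⊆ cl X :=
  fun _ hΦ K D h => hΦ K D fun _ hΨ => hΨ K D h

theorem derivable_of_mem_cl {X : Set (MetaFormula v Var)} {D : Formula v Var}
    (h : ∀ Ψ ∈ X, Derivable Ψ D) {Φ : MetaFormula v Var} (hΦ : Φ ∈ cl X) : Derivable Φ D := by
  have := hΦ Frame.id D
  simp only [Frame.app_id] at this
  exact this h

/-- A test of `K.app Φ` by `L` is a test of `Φ` by `L.comp K`. Membership of a filled frame in a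
closed set can thus be checked on generators alone. -/
theorem app_mem_of_mem_cl {X Y : Set (MetaFormula v Var)} (hX : cl X ⊆ X) (K : Frame v Var)
    (h : ∀ Ψ ∈ Y, K.app Ψ ∈ X) {Φ : MetaFormula v Var} (hΦ : Φ ∈ cl Y) : K.app Φ ∈ X := by
  refine hX fun L D hL => ?_
  rw [← Frame.app_comp]
  refine hΦ _ _ fun Ψ hΨ => ?_
  rw [Frame.app_comp]
  exact hL _ (h Ψ hΨ)

/-- Reads a left rule with one principal premise as a closure statement about active parts. -/
theorem mem_cl_singleton {Φ Ψ : MetaFormula v Var} :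
    Ψ ∈ cl {Φ} ↔ ∀ K D, Derivable (Frame.app K Φ) D → Derivable (Frame.app K Ψ) D := by
  simp [cl]

theorem mem_of_mem_cl_singleton {X : Set (MetaFormula v Var)} (hX : cl X ⊆ X)
    {Φ Ψ : MetaFormula v Var} (hΦ : Φ ∈ X) (h : Ψ ∈ cl {Φ}) : Ψ ∈ X :=
  hX (cl_mono (by simpa using hΦ) h)

-- The interpretation and its adequacy

open MetaFormula in
/-- The interpretation of formulae by sets of meta-formulae. -/
def sem : Formula v Var → Set (MetaFormula v Var)
  | var p => {Φ | Derivable Φ (var p)}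
  | one _ => cl {⟨0, []⟩}
  | ldiv A C => {Φ | (v = Version.restricted → Φ.NonVacuous) ∧ ∀ Ψ ∈ sem A, mul Ψ Φ ∈ sem C}
  | rdiv C B => {Φ | (v = Version.restricted → Φ.NonVacuous) ∧ ∀ Ψ ∈ sem B, mul Φ Ψ ∈ sem C}
  | prod A B => cl {Φ | ∃ Ψ ∈ sem A, ∃ Θ ∈ sem B, Φ = mul Ψ Θ}
  | disj A B => cl (sem A ∪ sem B)
  | conj A B => sem A ∩ sem B
  | dia A => cl {Φ | ∃ Ψ ∈ sem A, Φ = ⟨0, [br Ψ]⟩}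
  | boxInv A => {Φ | (⟨0, [br Φ]⟩ : MetaFormula v Var) ∈ sem A}
  | bang A => cl {Φ | Φ ∈ sem A ∧ ∃ B, Φ = ⟨{B}, []⟩}

namespace Derivable

variable (K : Frame v Var) {A B C D : Formula v Var} {ζ : Stoup v Var}
  {Γ : List (TreeTerm v Var)}

theorem frame_rdivL (h₁ : Derivable ⟨ζ, Γ⟩ B) (h₂ : Derivable (K.app ⟨0, [fm C]⟩) D) :
    Derivable (K.app ⟨ζ, fm (rdiv C B) :: Γ⟩) D := by
  simpa [Frame.app] using rdivL K.ctx ζ K.stoup K.left Γ K.right B C D h₁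
    (by simpa [Frame.app] using h₂)

theorem frame_ldivL (h₁ : Derivable ⟨ζ, Γ⟩ A) (h₂ : Derivable (K.app ⟨0, [fm C]⟩) D) :
    Derivable (K.app ⟨ζ, Γ ++ [fm (ldiv A C)]⟩) D := by
  simpa [Frame.app] using ldivL K.ctx ζ K.stoup K.left Γ K.right A C D h₁
    (by simpa [Frame.app] using h₂)

theorem frame_prodL (h : Derivable (K.app ⟨0, [fm A, fm B]⟩) D) :
    Derivable (K.app ⟨0, [fm (prod A B)]⟩) D := by
  simpa [Frame.app] using prodL K.ctx K.stoup K.left K.right A B D (by simpa [Frame.app] using h)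

theorem frame_oneL (hv : v = Version.star) (h : Derivable (K.app ⟨0, []⟩) D) :
    Derivable (K.app ⟨0, [fm (one hv)]⟩) D := by
  simpa [Frame.app] using oneL hv K.ctx K.stoup K.left K.right D (by simpa [Frame.app] using h)

theorem frame_disjL (h₁ : Derivable (K.app ⟨0, [fm A]⟩) D)
    (h₂ : Derivable (K.app ⟨0, [fm B]⟩) D) : Derivable (K.app ⟨0, [fm (disj A B)]⟩) D := by
  simpa [Frame.app] using disjL K.ctx K.stoup K.left K.right A B D
    (by simpa [Frame.app] using h₁) (by simpa [Frame.app] using h₂)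

theorem frame_conjL₁ (h : Derivable (K.app ⟨0, [fm A]⟩) D) :
    Derivable (K.app ⟨0, [fm (conj A B)]⟩) D := by
  simpa [Frame.app] using conjL₁ K.ctx K.stoup K.left K.right A B D (by simpa [Frame.app] using h)

theorem frame_conjL₂ (h : Derivable (K.app ⟨0, [fm B]⟩) D) :
    Derivable (K.app ⟨0, [fm (conj A B)]⟩) D := by
  simpa [Frame.app] using conjL₂ K.ctx K.stoup K.left K.right A B D (by simpa [Frame.app] using h)

theorem frame_boxInvL (h : Derivable (K.app ⟨0, [fm A]⟩) D) :
    Derivable (K.app ⟨0, [br ⟨0, [fm (boxInv A)]⟩]⟩) D := by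
  simpa [Frame.app] using boxInvL K.ctx K.stoup K.left K.right A D (by simpa [Frame.app] using h)

theorem frame_diaL (h : Derivable (K.app ⟨0, [br ⟨0, [fm A]⟩]⟩) D) :
    Derivable (K.app ⟨0, [fm (dia A)]⟩) D := by
  simpa [Frame.app] using diaL K.ctx K.stoup K.left K.right A D (by simpa [Frame.app] using h)

theorem frame_bangL (h : Derivable (K.app ⟨{A}, []⟩) D) :
    Derivable (K.app ⟨0, [fm (bang A)]⟩) D := by
  simpa [Frame.app] using bangL K.ctx K.stoup K.left K.right A D
    (by simpa [Frame.app, add_comm] using h)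

theorem frame_bangP (h : Derivable (K.app ⟨0, [fm A]⟩) D) :
    Derivable (K.app ⟨{A}, []⟩) D := by
  simpa [Frame.app, add_comm] using bangP K.ctx K.stoup K.left K.right A D
    (by simpa [Frame.app] using h)

theorem frame_bangC (hr : v = Version.restricted → Γ ≠ [] ∨ ζ ≠ 0)
    (h : Derivable (K.app ⟨{A}, [br ⟨ζ + {A}, Γ⟩]⟩) D) :
    Derivable (K.app ⟨{A}, [br ⟨0, [br ⟨ζ, Γ⟩]⟩]⟩) D := by
  simpa [Frame.app, add_comm] using bangC K.ctx K.stoup ζ K.left Γ K.right A D hr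
    (by simpa [Frame.app, add_comm] using h)

end Derivable

/-- Products with a fixed factor and bracketing are frames, so that `app_mem_of_mem_cl` applies to
the interpretations of divisions and `boxInv`. -/
theorem mul_eq_app_left (Ψ : MetaFormula v Var) :
    ∃ K : Frame v Var, ∀ Φ : MetaFormula v Var, Φ.mul Ψ = K.app Φ := by
  obtain ⟨η, Δ⟩ := Ψ
  exact ⟨⟨.hole, η, [], Δ⟩, fun Φ => by cases Φ; simp [MetaFormula.mul, Frame.app, Context.fill]⟩

theorem mul_eq_app_right (Ψ : MetaFormula v Var) :
    ∃ K : Frame v Var, ∀ Φ : MetaFormula v Var, Ψ.mul Φ = K.app Φ := by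
  obtain ⟨η, Δ⟩ := Ψ
  exact ⟨⟨.hole, η, Δ, []⟩, fun Φ => by
    cases Φ; simp [MetaFormula.mul, Frame.app, Context.fill, add_comm]⟩

theorem br_eq_app :
    ∃ K : Frame v Var, ∀ Φ : MetaFormula v Var, ⟨0, [br Φ]⟩ = K.app Φ :=
  ⟨⟨.inside 0 [] .hole [], 0, [], []⟩, fun Φ => by
    cases Φ; simp [Frame.app, Context.fill]⟩

/-- The interpretation of a formula is a closed set which contains the formula and all of whose
elements derive it. -/
theorem sem_spec (A : Formula v Var) :
    cl (sem A) ⊆ sem A ∧ (⟨0, [fm A]⟩ : MetaFormula v Var) ∈ sem A ∧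
      ∀ Φ ∈ sem A, Derivable Φ A := by
  induction A with
  | var p =>
    exact ⟨fun Φ hΦ => derivable_of_mem_cl (fun Ψ hΨ => hΨ) hΦ, .id _, fun Φ hΦ => hΦ⟩
  | one hv =>
    refine ⟨cl_cl _, mem_cl_singleton.2 fun K D => .frame_oneL K hv, fun Φ hΦ =>
      derivable_of_mem_cl ?_ hΦ⟩
    rintro Ψ rfl
    exact .oneR hv
  | ldiv A C ihA ihC =>
    -- Needed before closedness: elements of the closure then also derive `ldiv A C`, so under the
    -- restriction they are not vacuous.
    have hd : ∀ Φ ∈ sem (ldiv A C), Derivable Φ (ldiv A C) := by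
      rintro ⟨ζ, Γ⟩ ⟨hr, h⟩
      refine .ldivR _ _ _ _ hr ?_
      simpa [MetaFormula.mul] using ihC.2.2 _ (h _ ihA.2.1)
    refine ⟨fun Φ hΦ => ⟨fun hv => ((derivable_of_mem_cl hd hΦ).legal hv).nonVacuous,
      fun Ψ hΨ => ?_⟩, ⟨fun _ => by simp [MetaFormula.NonVacuous], fun Ψ hΨ => ?_⟩, hd⟩
    · obtain ⟨K, hK⟩ := mul_eq_app_right Ψ
      rw [hK]
      exact app_mem_of_mem_cl ihC.1 K (fun Θ hΘ => hK Θ ▸ hΘ.2 Ψ hΨ) hΦ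
    · refine mem_of_mem_cl_singleton ihC.1 ihC.2.1 (mem_cl_singleton.2 fun K D h => ?_)
      have hA := ihA.2.2 Ψ hΨ
      cases Ψ
      simpa [MetaFormula.mul] using Derivable.frame_ldivL K hA h
  | rdiv C B ihC ihB =>
    have hd : ∀ Φ ∈ sem (rdiv C B), Derivable Φ (rdiv C B) := by
      rintro ⟨ζ, Γ⟩ ⟨hr, h⟩
      refine .rdivR _ _ _ _ hr ?_
      simpa [MetaFormula.mul] using ihC.2.2 _ (h _ ihB.2.1)
    refine ⟨fun Φ hΦ => ⟨fun hv => ((derivable_of_mem_cl hd hΦ).legal hv).nonVacuous,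
      fun Ψ hΨ => ?_⟩, ⟨fun _ => by simp [MetaFormula.NonVacuous], fun Ψ hΨ => ?_⟩, hd⟩
    · obtain ⟨K, hK⟩ := mul_eq_app_left Ψ
      rw [hK]
      exact app_mem_of_mem_cl ihC.1 K (fun Θ hΘ => hK Θ ▸ hΘ.2 Ψ hΨ) hΦ
    · refine mem_of_mem_cl_singleton ihC.1 ihC.2.1 (mem_cl_singleton.2 fun K D h => ?_)
      have hB := ihB.2.2 Ψ hΨ
      cases Ψ
      simpa [MetaFormula.mul] using Derivable.frame_rdivL K hB h
  | prod A B ihA ihB =>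
    refine ⟨cl_cl _, fun K D h => .frame_prodL K (h _ ⟨_, ihA.2.1, _, ihB.2.1, ?_⟩),
      fun Φ hΦ => derivable_of_mem_cl ?_ hΦ⟩
    · simp [MetaFormula.mul]
    · rintro _ ⟨⟨ζ₁, Γ₁⟩, h₁, ⟨ζ₂, Γ₂⟩, h₂, rfl⟩
      exact .prodR _ _ _ _ _ _ (ihA.2.2 _ h₁) (ihB.2.2 _ h₂)
  | disj A B ihA ihB =>
    refine ⟨cl_cl _, fun K D h => .frame_disjL K (h _ (.inl ihA.2.1)) (h _ (.inr ihB.2.1)),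
      fun Φ hΦ => derivable_of_mem_cl ?_ hΦ⟩
    rintro Ψ (h | h)
    · exact .disjR₁ _ _ _ (ihA.2.2 _ h)
    · exact .disjR₂ _ _ _ (ihB.2.2 _ h)
  | conj A B ihA ihB =>
    refine ⟨fun Φ hΦ => ⟨ihA.1 (cl_mono Set.inter_subset_left hΦ),
      ihB.1 (cl_mono Set.inter_subset_right hΦ)⟩, ⟨?_, ?_⟩,
      fun Φ hΦ => .conjR _ _ _ (ihA.2.2 _ hΦ.1) (ihB.2.2 _ hΦ.2)⟩
    · exact mem_of_mem_cl_singleton ihA.1 ihA.2.1 (mem_cl_singleton.2 fun K D => .frame_conjL₁ K)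
    · exact mem_of_mem_cl_singleton ihB.1 ihB.2.1 (mem_cl_singleton.2 fun K D => .frame_conjL₂ K)
  | dia A ih =>
    refine ⟨cl_cl _, fun K D h => .frame_diaL K (h _ ⟨_, ih.2.1, rfl⟩),
      fun Φ hΦ => derivable_of_mem_cl ?_ hΦ⟩
    rintro _ ⟨Ψ, h, rfl⟩
    exact .diaR _ _ (ih.2.2 _ h)
  | boxInv A ih =>
    refine ⟨fun Φ hΦ => ?_, mem_of_mem_cl_singleton ih.1 ih.2.1
      (mem_cl_singleton.2 fun K D => .frame_boxInvL K), fun Φ hΦ => .boxInvR _ _ (ih.2.2 _ hΦ)⟩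
    obtain ⟨K, hK⟩ := br_eq_app (v := v) (Var := Var)
    change _ ∈ sem A
    rw [hK]
    exact app_mem_of_mem_cl ih.1 K (fun Ψ hΨ => hK Ψ ▸ hΨ) hΦ
  | bang A ih =>
    refine ⟨cl_cl _, fun K D h => .frame_bangL K (h _ ⟨?_, A, rfl⟩),
      fun Φ hΦ => derivable_of_mem_cl ?_ hΦ⟩
    · exact mem_of_mem_cl_singleton ih.1 ih.2.1 (mem_cl_singleton.2 fun K D => .frame_bangP K)
    -- The generators are one-formula stoups, the only antecedents to which `bangR` applies.
    · rintro _ ⟨h, B, rfl⟩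
      exact .bangR _ _ (ih.2.2 _ h)

theorem cl_sem_subset (A : Formula v Var) : cl (sem A) ⊆ sem A := (sem_spec A).1

theorem fm_mem_sem (A : Formula v Var) : (⟨0, [fm A]⟩ : MetaFormula v Var) ∈ sem A :=
  (sem_spec A).2.1

theorem derivable_of_mem_sem {A : Formula v Var} {Φ : MetaFormula v Var} (h : Φ ∈ sem A) :
    Derivable Φ A :=
  (sem_spec A).2.2 Φ h

/-- By `!P` every test passed by `A` in the sequence is passed by `A` in the stoup. Hence stoups are
instances of themselves. -/
theorem stoup_mem_sem (A : Formula v Var) : (⟨{A}, []⟩ : MetaFormula v Var) ∈ sem A :=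
  mem_of_mem_cl_singleton (cl_sem_subset A) (fm_mem_sem A)
    (mem_cl_singleton.2 fun K _ => .frame_bangP K)

-- Instances of meta-formulae

/-- `ζ'` arises from `ζ` by replacing each formula by one whose stoup occurrence belongs to its
interpretation. -/
abbrev InstStoup (ζ ζ' : Stoup v Var) : Prop :=
  Multiset.Rel (fun A B => (⟨{B}, []⟩ : MetaFormula v Var) ∈ sem A) ζ ζ'

/-- `InstSeq Γ ζ' Γ'` says that `ζ'; Γ'` arises from the sequence `Γ` by replacing formulae by
elements of their interpretations. -/
inductive InstSeq :
    List (TreeTerm v Var) → Stoup v Var → List (TreeTerm v Var) → Prop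
  | nil : InstSeq [] 0 []
  | fm {A : Formula v Var} {Γ Δ Γ' : List (TreeTerm v Var)} {ζ ζ' : Stoup v Var} :
      ⟨ζ, Δ⟩ ∈ sem A → InstSeq Γ ζ' Γ' → InstSeq (fm A :: Γ) (ζ + ζ') (Δ ++ Γ')
  | br {η η' δ ζ' : Stoup v Var} {Δ Δ' Γ Γ' : List (TreeTerm v Var)} :
      InstStoup η η' → InstSeq Δ δ Δ' → InstSeq Γ ζ' Γ' →
      InstSeq (br ⟨η, Δ⟩ :: Γ) ζ' (br ⟨η' + δ, Δ'⟩ :: Γ')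

/-- `Inst Φ Φ'` says that `Φ'` arises from `Φ` by replacing formulae by elements of their
interpretations. -/
def Inst : MetaFormula v Var → MetaFormula v Var → Prop
  | ⟨ζ, Γ⟩, Φ' => ∃ η δ Γ', InstStoup ζ η ∧ InstSeq Γ δ Γ' ∧ Φ' = ⟨η + δ, Γ'⟩

theorem instSeq_nil {ζ : Stoup v Var} {Γ : List (TreeTerm v Var)} :
    InstSeq [] ζ Γ ↔ ζ = 0 ∧ Γ = [] := by
  refine ⟨fun h => ?_, ?_⟩
  · cases h; simp
  · rintro ⟨rfl, rfl⟩; exact .nil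

theorem instSeq_br {Φ : MetaFormula v Var} {ζ : Stoup v Var} {Γ Γ' : List (TreeTerm v Var)} :
    InstSeq (br Φ :: Γ) ζ Γ' ↔ ∃ Φ' Γ'', Inst Φ Φ' ∧ InstSeq Γ ζ Γ'' ∧ Γ' = br Φ' :: Γ'' := by
  obtain ⟨η, Δ⟩ := Φ
  constructor
  · intro h
    cases h with
    | br h₁ h₂ h₃ => exact ⟨_, _, ⟨_, _, _, h₁, h₂, rfl⟩, h₃, rfl⟩
  · rintro ⟨_, Γ'', ⟨_, _, _, h₁, h₂, rfl⟩, h₃, rfl⟩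
    exact .br h₁ h₂ h₃

theorem instSeq_fm_iff {A : Formula v Var} {ζ : Stoup v Var} {Γ Γ' : List (TreeTerm v Var)} :
    InstSeq (fm A :: Γ) ζ Γ' ↔ ∃ η Δ δ Δ', ⟨η, Δ⟩ ∈ sem A ∧ InstSeq Γ δ Δ' ∧
      ζ = η + δ ∧ Γ' = Δ ++ Δ' := by
  constructor
  · intro h
    cases h with
    | fm h₁ h₂ => exact ⟨_, _, _, _, h₁, h₂, rfl, rfl⟩
  · rintro ⟨_, _, _, _, h₁, h₂, rfl, rfl⟩
    exact .fm h₁ h₂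

theorem InstSeq.append {Γ Δ Γ' Δ' : List (TreeTerm v Var)} {ζ η : Stoup v Var}
    (h₁ : InstSeq Γ ζ Γ') (h₂ : InstSeq Δ η Δ') : InstSeq (Γ ++ Δ) (ζ + η) (Γ' ++ Δ') := by
  induction h₁ with
  | nil => simpa using h₂
  | fm h _ ih => simpa [add_assoc] using InstSeq.fm h ih
  | br h₁ h₂ _ _ ih => exact .br h₁ h₂ ih

theorem InstSeq.exists_of_append {Γ Δ Θ : List (TreeTerm v Var)} {ζ : Stoup v Var}
    (h : InstSeq (Γ ++ Δ) ζ Θ) : ∃ η δ Γ' Δ', InstSeq Γ η Γ' ∧ InstSeq Δ δ Δ' ∧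
      ζ = η + δ ∧ Θ = Γ' ++ Δ' := by
  induction Γ generalizing ζ Θ with
  | nil => exact ⟨0, ζ, [], Θ, .nil, h, by simp, rfl⟩
  | cons T Γ ih =>
    cases T with
    | fm A =>
      obtain ⟨α, Λ, _, _, hA, h', rfl, rfl⟩ := instSeq_fm_iff.1 h
      obtain ⟨η, δ, Γ', Δ', h₁, h₂, rfl, rfl⟩ := ih h'
      exact ⟨_, _, _, _, .fm hA h₁, h₂, by rw [add_assoc], by simp⟩
    | br Φ =>
      obtain ⟨Φ', _, hΦ, h', rfl⟩ := instSeq_br.1 h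
      obtain ⟨η, δ, Γ', Δ', h₁, h₂, rfl, rfl⟩ := ih h'
      exact ⟨_, _, _, _, instSeq_br.2 ⟨_, _, hΦ, h₁, rfl⟩, h₂, rfl, rfl⟩

theorem Inst.mul {Φ Φ' Ψ Ψ' : MetaFormula v Var} (h₁ : Inst Φ Φ') (h₂ : Inst Ψ Ψ') :
    Inst (Φ.mul Ψ) (Φ'.mul Ψ') := by
  cases Φ; cases Ψ
  obtain ⟨_, _, _, h₁, h₁', rfl⟩ := h₁
  obtain ⟨_, _, _, h₂, h₂', rfl⟩ := h₂
  exact ⟨_, _, _, h₁.add h₂, h₁'.append h₂', by simp only [MetaFormula.mul, add_add_add_comm]⟩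

theorem Inst.exists_of_mul {Φ Ψ Θ : MetaFormula v Var} (h : Inst (Φ.mul Ψ) Θ) :
    ∃ Φ' Ψ', Inst Φ Φ' ∧ Inst Ψ Ψ' ∧ Θ = Φ'.mul Ψ' := by
  cases Φ; cases Ψ
  obtain ⟨_, _, _, h, h', rfl⟩ := h
  obtain ⟨_, _, h₁, h₂, rfl⟩ := Multiset.rel_add_left.1 h
  obtain ⟨_, _, _, _, h₁', h₂', rfl, rfl⟩ := h'.exists_of_append
  exact ⟨_, _, ⟨_, _, _, h₁, h₁', rfl⟩, ⟨_, _, _, h₂, h₂', rfl⟩, by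
    simp only [MetaFormula.mul, add_add_add_comm]⟩

theorem inst_nil {Φ : MetaFormula v Var} : Inst ⟨0, []⟩ Φ ↔ Φ = ⟨0, []⟩ := by
  simp [Inst, InstStoup, instSeq_nil, Multiset.rel_zero_left]

theorem inst_fm {A : Formula v Var} {Φ : MetaFormula v Var} :
    Inst ⟨0, [fm A]⟩ Φ ↔ Φ ∈ sem A := by
  constructor
  · rintro ⟨_, _, _, h, h', rfl⟩
    obtain rfl := Multiset.rel_zero_left.1 h
    obtain ⟨_, _, _, _, hA, h'', rfl, rfl⟩ := instSeq_fm_iff.1 h'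
    obtain ⟨rfl, rfl⟩ := instSeq_nil.1 h''
    simpa using hA
  · intro h
    obtain ⟨ζ, Γ⟩ := Φ
    exact ⟨0, _, _, .zero, .fm h .nil, by simp⟩

theorem inst_br {Φ Ψ : MetaFormula v Var} :
    Inst ⟨0, [br Φ]⟩ Ψ ↔ ∃ Φ', Inst Φ Φ' ∧ Ψ = ⟨0, [br Φ']⟩ := by
  constructor
  · rintro ⟨_, _, _, h, h', rfl⟩
    obtain rfl := Multiset.rel_zero_left.1 h
    obtain ⟨Φ', _, hΦ, h'', rfl⟩ := instSeq_br.1 h'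
    obtain ⟨rfl, rfl⟩ := instSeq_nil.1 h''
    exact ⟨Φ', hΦ, by simp⟩
  · rintro ⟨Φ', h, rfl⟩
    exact ⟨0, 0, _, .zero, instSeq_br.2 ⟨_, _, h, .nil, rfl⟩, by simp⟩

theorem inst_stoup {A : Formula v Var} {Φ : MetaFormula v Var} :
    Inst ⟨{A}, []⟩ Φ ↔ ∃ B, (⟨{B}, []⟩ : MetaFormula v Var) ∈ sem A ∧ Φ = ⟨{B}, []⟩ := by
  constructor
  · rintro ⟨_, _, _, h, h', rfl⟩
    obtain ⟨rfl, rfl⟩ := instSeq_nil.1 h'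
    obtain ⟨B, _, hB, h'', rfl⟩ := Multiset.rel_cons_left.1 h
    obtain rfl := Multiset.rel_zero_left.1 h''
    exact ⟨B, hB, by simp⟩
  · rintro ⟨B, hB, rfl⟩
    exact ⟨{B}, 0, [], .cons hB .zero, .nil, by simp⟩

theorem Frame.app_hole (ζ : Stoup v Var) (Γ₁ Γ₂ : List (TreeTerm v Var))
    (Θ : MetaFormula v Var) :
    Frame.app ⟨.hole, ζ, Γ₁, Γ₂⟩ Θ = (MetaFormula.mul ⟨ζ, Γ₁⟩ Θ).mul ⟨0, Γ₂⟩ := by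
  cases Θ; simp [Frame.app, Context.fill, MetaFormula.mul, add_comm]

theorem Frame.app_inside (Ξ : Context v Var) (ζ η : Stoup v Var)
    (Γ₁ Γ₂ Δ₁ Δ₂ : List (TreeTerm v Var)) (Θ : MetaFormula v Var) :
    Frame.app ⟨.inside η Δ₁ Ξ Δ₂, ζ, Γ₁, Γ₂⟩ Θ =
      ⟨η, Δ₁ ++ br (Frame.app ⟨Ξ, ζ, Γ₁, Γ₂⟩ Θ) :: Δ₂⟩ := by
  cases Θ; rfl

/-- An instance of a filled frame is an instance of the frame filled with an instance. -/
theorem Inst.exists_of_app (K : Frame v Var) {Φ Ψ : MetaFormula v Var} (h : Inst (K.app Φ) Ψ) :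
    ∃ (K' : Frame v Var) (Φ' : MetaFormula v Var), Ψ = K'.app Φ' ∧ Inst Φ Φ' ∧
      ∀ Θ Θ', Inst Θ Θ' → Inst (K.app Θ) (K'.app Θ') := by
  obtain ⟨Ξ, ζ, Γ₁, Γ₂⟩ := K
  induction Ξ generalizing Ψ with
  | hole =>
    rw [Frame.app_hole] at h
    obtain ⟨_, ⟨ζ₂, Δ₂⟩, h', h₃, rfl⟩ := h.exists_of_mul
    obtain ⟨⟨ζ₁, Δ₁⟩, Φ', h₁, h₂, rfl⟩ := h'.exists_of_mul
    -- Elements replacing the formulae of `Γ₂` may carry stoups; `ζ₂` collects these, so it need not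
    -- be empty.
    have key' : ∀ Θ : MetaFormula v Var, Frame.app ⟨.hole, ζ₁ + ζ₂, Δ₁, Δ₂⟩ Θ =
        (MetaFormula.mul ⟨ζ₁, Δ₁⟩ Θ).mul ⟨ζ₂, Δ₂⟩ := fun Θ => by
      cases Θ; simp [Frame.app, Context.fill, MetaFormula.mul, add_left_comm, add_assoc]
    refine ⟨⟨.hole, ζ₁ + ζ₂, Δ₁, Δ₂⟩, Φ', (key' Φ').symm, h₂, fun Θ Θ' hΘ => ?_⟩
    rw [Frame.app_hole, key']
    exact (h₁.mul hΘ).mul h₃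
  | inside η Δ₁ Ξ Δ₂ ih =>
    rw [Frame.app_inside] at h
    obtain ⟨η', δ, _, hη, h, rfl⟩ := h
    obtain ⟨δ₁, δ₂, Δ₁', _, h₁, h', rfl, rfl⟩ := h.exists_of_append
    obtain ⟨_, Δ₂', hΦ, h₂, rfl⟩ := instSeq_br.1 h'
    obtain ⟨⟨Ξ', ζ', Γ₁', Γ₂'⟩, Φ', rfl, hΦ', hK⟩ := ih hΦ
    refine ⟨⟨.inside (η' + (δ₁ + δ₂)) Δ₁' Ξ' Δ₂', ζ', Γ₁', Γ₂'⟩, Φ', (Frame.app_inside ..).symm, hΦ',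
      fun Θ Θ' hΘ => ?_⟩
    rw [Frame.app_inside, Frame.app_inside]
    exact ⟨_, _, _, hη, h₁.append (instSeq_br.2 ⟨_, _, hK _ _ hΘ, h₂, rfl⟩), rfl⟩

theorem nonVacuous_of_mem_sem (hv : v = Version.restricted) {A : Formula v Var}
    {Φ : MetaFormula v Var} (h : Φ ∈ sem A) : Φ.NonVacuous :=
  ((derivable_of_mem_sem h).legal hv).nonVacuous

/-- Elements of an interpretation are derivable antecedents, hence not vacuous; brackets survive
instantiation, and stoups keep their size. Thus the side conditions of the restricted rules pass to
instances. -/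
theorem Inst.nonVacuous (hv : v = Version.restricted) {Φ Φ' : MetaFormula v Var}
    (h : Inst Φ Φ') (hΦ : Φ.NonVacuous) : Φ'.NonVacuous := by
  obtain ⟨ζ, Γ⟩ := Φ
  obtain ⟨η, δ, Γ', hζ, hΓ, rfl⟩ := h
  rcases hΦ with hΦ | hΦ
  · cases hΓ with
    | nil => exact absurd rfl hΦ
    | fm hA _ =>
      rcases nonVacuous_of_mem_sem hv hA with h | h
      · exact .inl (by simp [h])
      · exact .inr (by simp [h])
    | br => exact .inl (by simp)
  · refine .inr fun h0 => hΦ ?_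
    obtain ⟨rfl, -⟩ := add_eq_zero.1 h0
    exact Multiset.rel_zero_right.1 hζ

theorem instStoup_refl (ζ : Stoup v Var) : InstStoup ζ ζ :=
  Multiset.rel_refl_of_refl_on fun A _ => stoup_mem_sem A

theorem InstSeq.refl : ∀ Γ : List (TreeTerm v Var), InstSeq Γ 0 Γ
  | [] => .nil
  | .fm A :: Γ => by simpa using InstSeq.fm (fm_mem_sem A) (InstSeq.refl Γ)
  | .br ⟨η, Δ⟩ :: Γ => by
    simpa using InstSeq.br (instStoup_refl η) (InstSeq.refl Δ) (InstSeq.refl Γ)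

theorem Inst.refl : ∀ Φ : MetaFormula v Var, Inst Φ Φ
  | ⟨ζ, Γ⟩ => ⟨ζ, 0, Γ, instStoup_refl ζ, .refl Γ, by simp⟩

/-- The frame is its own instance, so only the designated part changes; in the main theorem this
part is the cut formula. -/
theorem Inst.app (K : Frame v Var) {Φ Φ' : MetaFormula v Var} (h : Inst Φ Φ') :
    Inst (K.app Φ) (K.app Φ') := by
  obtain ⟨Ξ, ζ, Γ₁, Γ₂⟩ := K
  induction Ξ with
  | hole =>
    rw [Frame.app_hole, Frame.app_hole]
    exact ((Inst.refl _).mul h).mul (.refl _)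
  | inside η Δ₁ Ξ Δ₂ ih =>
    rw [Frame.app_inside, Frame.app_inside]
    exact ⟨η, 0, _, instStoup_refl η,
      (add_zero (0 : Stoup v Var)) ▸
        (InstSeq.refl Δ₁).append (instSeq_br.2 ⟨_, _, ih, .refl Δ₂, rfl⟩), by simp⟩

/-- To validate a left rule it suffices to do so for the active part of the conclusion. -/
theorem app_mem_of_forall_inst {K : Frame v Var} {Φ Ψ : MetaFormula v Var} {D : Formula v Var}
    (h : ∀ Φ', Inst Φ Φ' → ∀ K' : Frame v Var,
      (∀ Θ Θ', Inst Θ Θ' → Inst (K.app Θ) (K'.app Θ')) → K'.app Φ' ∈ sem D)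
    (hΨ : Inst (K.app Φ) Ψ) : Ψ ∈ sem D := by
  obtain ⟨K', Φ', rfl, hΦ, hK⟩ := Inst.exists_of_app K hΨ
  exact h Φ' hΦ K' hK

-- Soundness of the interpretation

/-- Every instance of the antecedent of a derivable sequent belongs to the interpretation of the
succedent. -/
theorem Derivable.sound {Φ : MetaFormula v Var} {A : Formula v Var} (h : Derivable Φ A)
    {Φ' : MetaFormula v Var} (hΦ : Inst Φ Φ') : Φ' ∈ sem A := by
  induction h generalizing Φ' with
  | id A => exact inst_fm.1 hΦ
  | rdivL Ξ ζ₁ ζ₂ Δ₁ Γ Δ₂ B C D _ _ ih₁ ih₂ =>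
    refine app_mem_of_forall_inst (K := ⟨Ξ, ζ₂, Δ₁, Δ₂⟩) (Φ := .mul ⟨0, [fm (rdiv C B)]⟩ ⟨ζ₁, Γ⟩)
      (fun Ψ hΨ K' hK' => ?_) (by simpa [Frame.app, MetaFormula.mul] using hΦ)
    obtain ⟨Ψ₁, Ψ₂, h₁, h₂, rfl⟩ := hΨ.exists_of_mul
    refine ih₂ ?_
    -- The instance of `rdiv C B` times that of `Γ` with its stoup lies in `sem C`, so it may stand
    -- for `C` in the second premise.
    simpa [Frame.app] using hK' _ _ (inst_fm.2 ((inst_fm.1 h₁).2 _ (ih₁ h₂)))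
  | ldivL Ξ ζ₁ ζ₂ Δ₁ Γ Δ₂ A C D _ _ ih₁ ih₂ =>
    refine app_mem_of_forall_inst (K := ⟨Ξ, ζ₂, Δ₁, Δ₂⟩) (Φ := .mul ⟨ζ₁, Γ⟩ ⟨0, [fm (ldiv A C)]⟩)
      (fun Ψ hΨ K' hK' => ?_) (by simpa [Frame.app, MetaFormula.mul] using hΦ)
    obtain ⟨Ψ₁, Ψ₂, h₁, h₂, rfl⟩ := hΨ.exists_of_mul
    refine ih₂ ?_
    simpa [Frame.app] using hK' _ _ (inst_fm.2 ((inst_fm.1 h₂).2 _ (ih₁ h₁)))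
  | rdivR ζ Γ B C hr _ ih =>
    refine ⟨fun hv => hΦ.nonVacuous hv (hr hv), fun Ψ hΨ => ih ?_⟩
    simpa [MetaFormula.mul] using hΦ.mul (inst_fm.2 hΨ)
  | ldivR ζ Γ A C hr _ ih =>
    refine ⟨fun hv => hΦ.nonVacuous hv (hr hv), fun Ψ hΨ => ih ?_⟩
    simpa [MetaFormula.mul] using (inst_fm.2 hΨ).mul hΦ
  | prodL Ξ ζ Δ₁ Δ₂ A B D _ ih =>
    refine app_mem_of_forall_inst (K := ⟨Ξ, ζ, Δ₁, Δ₂⟩) (Φ := ⟨0, [fm (prod A B)]⟩)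
      (fun Ψ hΨ K' hK' => ?_) (by simpa [Frame.app] using hΦ)
    refine app_mem_of_mem_cl (cl_sem_subset D) K' ?_ (inst_fm.1 hΨ)
    rintro _ ⟨Ψ₁, h₁, Ψ₂, h₂, rfl⟩
    refine ih ?_
    simpa [Frame.app, MetaFormula.mul] using hK' _ _ ((inst_fm.2 h₁).mul (inst_fm.2 h₂))
  | prodR ζ₁ ζ₂ Δ Γ A B _ _ ih₁ ih₂ =>
    obtain ⟨Ψ₁, Ψ₂, h₁, h₂, rfl⟩ := Inst.exists_of_mul (Φ := ⟨ζ₁, Δ⟩) (Ψ := ⟨ζ₂, Γ⟩) hΦ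
    exact subset_cl _ ⟨_, ih₁ h₁, _, ih₂ h₂, rfl⟩
  | oneL hv Ξ ζ Δ₁ Δ₂ A _ ih =>
    refine app_mem_of_forall_inst (K := ⟨Ξ, ζ, Δ₁, Δ₂⟩) (Φ := ⟨0, [fm (one hv)]⟩)
      (fun Ψ hΨ K' hK' => ?_) (by simpa [Frame.app] using hΦ)
    refine app_mem_of_mem_cl (cl_sem_subset A) K' ?_ (inst_fm.1 hΨ)
    rintro _ rfl
    refine ih ?_
    simpa [Frame.app] using hK' _ _ (inst_nil.2 rfl)
  | oneR hv => exact subset_cl _ (inst_nil.1 hΦ)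
  | disjL Ξ ζ Δ₁ Δ₂ A₁ A₂ C _ _ ih₁ ih₂ =>
    refine app_mem_of_forall_inst (K := ⟨Ξ, ζ, Δ₁, Δ₂⟩) (Φ := ⟨0, [fm (disj A₁ A₂)]⟩)
      (fun Ψ hΨ K' hK' => ?_) (by simpa [Frame.app] using hΦ)
    refine app_mem_of_mem_cl (cl_sem_subset C) K' ?_ (inst_fm.1 hΨ)
    rintro Θ (h | h)
    · exact ih₁ (by simpa [Frame.app] using hK' _ _ (inst_fm.2 h))
    · exact ih₂ (by simpa [Frame.app] using hK' _ _ (inst_fm.2 h))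
  | disjR₁ _ _ _ _ ih => exact subset_cl _ (.inl (ih hΦ))
  | disjR₂ _ _ _ _ ih => exact subset_cl _ (.inr (ih hΦ))
  | conjL₁ Ξ ζ Δ₁ Δ₂ A₁ A₂ C _ ih =>
    refine app_mem_of_forall_inst (K := ⟨Ξ, ζ, Δ₁, Δ₂⟩) (Φ := ⟨0, [fm (conj A₁ A₂)]⟩)
      (fun Ψ hΨ K' hK' => ih ?_) (by simpa [Frame.app] using hΦ)
    simpa [Frame.app] using hK' _ _ (inst_fm.2 (inst_fm.1 hΨ).1)
  | conjL₂ Ξ ζ Δ₁ Δ₂ A₁ A₂ C _ ih =>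
    refine app_mem_of_forall_inst (K := ⟨Ξ, ζ, Δ₁, Δ₂⟩) (Φ := ⟨0, [fm (conj A₁ A₂)]⟩)
      (fun Ψ hΨ K' hK' => ih ?_) (by simpa [Frame.app] using hΦ)
    simpa [Frame.app] using hK' _ _ (inst_fm.2 (inst_fm.1 hΨ).2)
  | conjR _ _ _ _ _ ih₁ ih₂ => exact ⟨ih₁ hΦ, ih₂ hΦ⟩
  | boxInvL Ξ ζ Δ₁ Δ₂ A B _ ih =>
    refine app_mem_of_forall_inst (K := ⟨Ξ, ζ, Δ₁, Δ₂⟩) (Φ := ⟨0, [br ⟨0, [fm (boxInv A)]⟩]⟩)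
      (fun Ψ hΨ K' hK' => ih ?_) (by simpa [Frame.app] using hΦ)
    obtain ⟨Θ, hΘ, rfl⟩ := inst_br.1 hΨ
    have hb : Θ ∈ sem (boxInv A) := inst_fm.1 hΘ
    have hA : (⟨0, [br Θ]⟩ : MetaFormula v Var) ∈ sem A := hb
    simpa [Frame.app] using hK' _ _ (inst_fm.2 hA)
  | boxInvR Ξ A _ ih => exact ih (inst_br.2 ⟨_, hΦ, rfl⟩)
  | diaL Ξ ζ Δ₁ Δ₂ A B _ ih =>
    refine app_mem_of_forall_inst (K := ⟨Ξ, ζ, Δ₁, Δ₂⟩) (Φ := ⟨0, [fm (dia A)]⟩)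
      (fun Ψ hΨ K' hK' => ?_) (by simpa [Frame.app] using hΦ)
    refine app_mem_of_mem_cl (cl_sem_subset B) K' ?_ (inst_fm.1 hΨ)
    rintro _ ⟨Θ, hΘ, rfl⟩
    refine ih ?_
    simpa [Frame.app] using hK' _ _ (inst_br.2 ⟨_, inst_fm.2 hΘ, rfl⟩)
  | diaR Ξ A _ ih =>
    obtain ⟨Ψ, hΨ, rfl⟩ := inst_br.1 hΦ
    exact subset_cl _ ⟨Ψ, ih hΨ, rfl⟩
  | bangL Ξ ζ Γ₁ Γ₂ A B _ ih =>
    refine app_mem_of_forall_inst (K := ⟨Ξ, ζ, Γ₁, Γ₂⟩) (Φ := ⟨0, [fm (bang A)]⟩)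
      (fun Ψ hΨ K' hK' => ?_) (by simpa [Frame.app] using hΦ)
    refine app_mem_of_mem_cl (cl_sem_subset B) K' ?_ (inst_fm.1 hΨ)
    rintro _ ⟨h, E, rfl⟩
    refine ih ?_
    simpa [Frame.app, add_comm] using hK' _ _ (inst_stoup.2 ⟨E, h, rfl⟩)
  | bangP Ξ ζ Γ₁ Γ₂ A B _ ih =>
    refine app_mem_of_forall_inst (K := ⟨Ξ, ζ, Γ₁, Γ₂⟩) (Φ := ⟨{A}, []⟩)
      (fun Ψ hΨ K' hK' => ih ?_) (by simpa [Frame.app, add_comm] using hΦ)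
    obtain ⟨E, hE, rfl⟩ := inst_stoup.1 hΨ
    simpa [Frame.app] using hK' _ _ (inst_fm.2 hE)
  | bangR A B _ ih =>
    obtain ⟨E, hE, rfl⟩ := inst_stoup.1 hΦ
    exact subset_cl _ ⟨ih hΦ, E, rfl⟩
  | bangC Ξ ζ ζ' Γ₁ Γ₂ Γ₃ A B hr _ ih =>
    refine app_mem_of_forall_inst (K := ⟨Ξ, ζ, Γ₁, Γ₃⟩)
      (Φ := .mul ⟨{A}, []⟩ ⟨0, [br ⟨0, [br ⟨ζ', Γ₂⟩]⟩]⟩)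
      (fun Ψ hΨ K' hK' => ?_) (by simpa [Frame.app, MetaFormula.mul, add_comm] using hΦ)
    obtain ⟨_, _, h₁, h₂, rfl⟩ := hΨ.exists_of_mul
    obtain ⟨E, hE, rfl⟩ := inst_stoup.1 h₁
    obtain ⟨_, h₃, rfl⟩ := inst_br.1 h₂
    obtain ⟨⟨δ, Δ⟩, h₄, rfl⟩ := inst_br.1 h₃
    have hprem : K'.app ⟨{E}, [br ⟨δ + {E}, Δ⟩]⟩ ∈ sem B := by
      refine ih ?_
      -- `h₁` is used inside the bracket and outside: both copies of `A` become the same `E`, so the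
      -- instantiated premise is again a premise of `!C'`.
      have h₅ := inst_br.2 ⟨_, h₄.mul h₁, rfl⟩
      simpa [Frame.app, MetaFormula.mul, add_comm] using hK' _ _ (h₁.mul h₅)
    refine mem_of_mem_cl_singleton (cl_sem_subset B) hprem (mem_cl_singleton.2 fun L D hL => ?_)
    rw [← Frame.app_comp] at hL ⊢
    simpa [MetaFormula.mul] using
      Derivable.frame_bangC (L.comp K') (fun hv => h₄.nonVacuous hv (hr hv)) hL

end BracketLambek

-- Admissibility of cut

theorem mainTheorem1 (v : BracketLambek.Version) {Var : Type*}
    (Ξ : BracketLambek.Context v Var) (ξ ζ : BracketLambek.Stoup v Var)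
    (Θ Γ₁ Γ₂ : List (BracketLambek.TreeTerm v Var)) (A C : BracketLambek.Formula v Var)
    (hleft : BracketLambek.Derivable ⟨ξ, Θ⟩ A)
    (hright : BracketLambek.Derivable (Ξ.fill ⟨ζ, Γ₁ ++ [BracketLambek.TreeTerm.fm A] ++ Γ₂⟩) C) :
    BracketLambek.Derivable (Ξ.fill ⟨ξ + ζ, Γ₁ ++ Θ ++ Γ₂⟩) C := by
  have hA := BracketLambek.inst_fm.2 (hleft.sound (BracketLambek.Inst.refl _))
  have h := hA.app ⟨Ξ, ζ, Γ₁, Γ₂⟩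
  simp only [BracketLambek.Frame.app, zero_add] at h
  exact BracketLambek.derivable_of_mem_sem (hright.sound h)
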